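/- A $2$-copula is a function $C\colon[0,1]^2\to\mathbb{R}$ with $C(0,v)=C(u,0)=0$, $C(1,v)=v$, $C(u,1)=u$ for all $u,v\in[0,1]$ and $C(u_2,v_2)-C(u_2,v_1)-C(u_1,v_2)+C(u_1,v_1)\ge 0$ whenever $0\le u_1\le u_2\le 1$ and $0\le v_1\le v_2\le 1$. Its partial derivatives $\partial_1 C$, $\partial_2 C$ exist almost everywhere along every line parallel to the corresponding axis. The Markov product of two $2$-copulas is $$(C_1*C_2)(u,v)=\int_0^1\partial_2C_1(u,t)\,\partial_1C_2(t,v)\,dt ,$$ and $C$ is called idempotent if $C*C=C$ on $[0,1]^2$. For $i\in\{1,2\}$, $C$ is called stochastically increasing (respectively decreasing) in the $i$-th component if for every fixed value in $[0,1]$ of the other argument the partial derivative $u_i\mapsto\partial_iC(u_1,u_2)$ is decreasing (respectively increasing) outside a Lebesgue null set, and stochastically monotone in the $i$-th component if it is stochastically increasing or stochastically decreasing in that component. Let $\Pi(u,v)=uv$. A $2$-copula $C$ is called an ordinal sum of $\Pi$ if there is a countable (possibly empty) family $((a_k,b_k))_{k\in\mathcal I}$ of pairwise disjoint nonempty open intervals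 contained in $(0,1)$ such that $$C(u,v)=\begin{cases}a_k+(b_k-a_k)\,\Pi\!\left(\frac{u-a_k}{b_k-a_k},\frac{v-a_k}{b_k-a_k}\right)&\text{if }(u,v)\in(a_k,b_k)^2\text{ for some }k\in\mathcal I,\\ \min(u,v)&\text{otherwise.}\end{cases}$$ Theorem. Let $C$ be a $2$-copula and let $i\in\{1,2\}$. 1. $C$ is stochastically monotone in the $i$-th component and idempotent if and only if $C$ is an ordinal sum of $\Pi$. 2. $C$ is stochastically decreasing in the $i$-th component and idempotent if and only if $C=\Pi$. 3. $C$ is stochastically increasing in the $i$-th component and idempotent if and only if $C$ is an ordinal sum of $\Pi$. 4. If $C$ is stochastically increasing in the $i$-th component and idempotent, then for all $u,v\in(0,1)$ the left-hand partial derivative $\partial_2^-C(u,v)$ exists and $$(v-C(v,v))\,\partial_2^-C(u,v)=C(u,v)-C(u,C(v,v)).$$ -/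

import Mathlib

open Set MeasureTheory

/-- A 2-copula: a bivariate distribution function on the unit square with uniform margins
(grounded, uniform margins, nonnegative mass of every rectangle). Only the values on the unit
square matter; the values elsewhere are unconstrained and are never used. -/
structure IsCopula (C : ℝ → ℝ → ℝ) : Prop where
  zero_left : ∀ v ∈ Icc (0 : ℝ) 1, C 0 v = 0
  zero_right : ∀ u ∈ Icc (0 : ℝ) 1, C u 0 = 0
  one_left : ∀ v ∈ Icc (0 : ℝ) 1, C 1 v = v
  one_right : ∀ u ∈ Icc (0 : ℝ) 1, C u 1 = u
  two_increasing : ∀ u₁ ∈ Icc (0 : ℝ) 1, ∀ u₂ ∈ Icc (0 : ℝ) 1,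
    ∀ v₁ ∈ Icc (0 : ℝ) 1, ∀ v₂ ∈ Icc (0 : ℝ) 1, u₁ ≤ u₂ → v₁ ≤ v₂ →
      0 ≤ C u₂ v₂ - C u₂ v₁ - C u₁ v₂ + C u₁ v₁

/-- The independence (product) copula `Π(u, v) = u v`. -/
def independenceCopula (u v : ℝ) : ℝ := u * v

/-- The upper Fréchet-Hoeffding bound `C⁺(u, v) = min u v`. -/
def upperFrechet (u v : ℝ) : ℝ := min u v

/-- The Markov product `(C₁ * C₂)(u, v) = ∫₀¹ ∂₂C₁(u, t) ∂₁C₂(t, v) dt`. For copulas the partial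
derivatives exist for almost every `t ∈ (0, 1)`. -/
noncomputable def markovProduct (C₁ C₂ : ℝ → ℝ → ℝ) (u v : ℝ) : ℝ :=
  ∫ t in (0 : ℝ)..1, deriv (fun s => C₁ u s) t * deriv (fun s => C₂ s v) t

/-- `C` is idempotent for the Markov product: `C * C = C` on the unit square. -/
def IsMarkovIdempotent (C : ℝ → ℝ → ℝ) : Prop :=
  ∀ u ∈ Icc (0 : ℝ) 1, ∀ v ∈ Icc (0 : ℝ) 1, markovProduct C C u v = C u v

/-- `C` as a function of its `i`-th argument (`0` is the first), the other one being fixed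
to `w`. -/
def componentSection (C : ℝ → ℝ → ℝ) (i : Fin 2) (w : ℝ) : ℝ → ℝ :=
  if i = 0 then fun s => C s w else fun s => C w s

/-- `C` is stochastically increasing in the `i`-th component: for every value of the other
argument, the partial derivative `∂ᵢ C` exists and is decreasing off a null set. -/
def StochIncreasing (C : ℝ → ℝ → ℝ) (i : Fin 2) : Prop :=
  ∀ w ∈ Icc (0 : ℝ) 1, ∃ N : Set ℝ, volume N = 0 ∧
    (∀ s ∈ Ioo (0 : ℝ) 1 \ N, DifferentiableAt ℝ (componentSection C i w) s) ∧
    AntitoneOn (deriv (componentSection C i w)) (Ioo (0 : ℝ) 1 \ N)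

/-- `C` is stochastically decreasing in the `i`-th component: for every value of the other
argument, the partial derivative `∂ᵢ C` exists and is increasing off a null set. -/
def StochDecreasing (C : ℝ → ℝ → ℝ) (i : Fin 2) : Prop :=
  ∀ w ∈ Icc (0 : ℝ) 1, ∃ N : Set ℝ, volume N = 0 ∧
    (∀ s ∈ Ioo (0 : ℝ) 1 \ N, DifferentiableAt ℝ (componentSection C i w) s) ∧
    MonotoneOn (deriv (componentSection C i w)) (Ioo (0 : ℝ) 1 \ N)

/-- `C` is stochastically monotone in the `i`-th component. -/
def StochMonotone (C : ℝ → ℝ → ℝ) (i : Fin 2) : Prop :=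
  StochIncreasing C i ∨ StochDecreasing C i

/-- `C` is the ordinal sum of the copulas `D k` with respect to the pairwise disjoint open
intervals `(a k, b k)` contained in `(0, 1)`. -/
structure IsOrdinalSum {ι : Type} (a b : ι → ℝ) (D : ι → ℝ → ℝ → ℝ) (C : ℝ → ℝ → ℝ) :
    Prop where
  countable : Countable ι
  nonneg : ∀ k, 0 ≤ a k
  lt : ∀ k, a k < b k
  le_one : ∀ k, b k ≤ 1
  disjoint : Pairwise fun k l => Disjoint (Ioo (a k) (b k)) (Ioo (a l) (b l))
  copula : ∀ k, IsCopula (D k)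
  eq_inside : ∀ k, ∀ u ∈ Ioo (a k) (b k), ∀ v ∈ Ioo (a k) (b k),
    C u v = a k + (b k - a k) * D k ((u - a k) / (b k - a k)) ((v - a k) / (b k - a k))
  eq_outside : ∀ u ∈ Icc (0 : ℝ) 1, ∀ v ∈ Icc (0 : ℝ) 1,
    (¬ ∃ k, u ∈ Ioo (a k) (b k) ∧ v ∈ Ioo (a k) (b k)) → C u v = upperFrechet u v

/-- `C` is an ordinal sum of `D`: all summands are equal to `D`. The family of intervals may be
empty, in which case `C` is the upper Fréchet-Hoeffding bound. -/
def IsOrdinalSumOf (D C : ℝ → ℝ → ℝ) : Prop :=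
  ∃ (ι : Type) (a b : ι → ℝ), IsOrdinalSum a b (fun _ => D) C

/-! Everything turns on the fixed points p = C(p,p) of the diagonal. Fix v and let g = ∂₁C(·,v).
Idempotence gives ∫₀¹ ∂₂C(u,t) g(t) dt = C(u,v) = ∫₀ᵘ g, so h = ∂₂C(u,·) − 1_[0,u] is orthogonal to
g. The primitive C(u,s) − min(u,s) of h is nonpositive. If g is decreasing, its superlevel sets are,
up to null sets, initial intervals (0,p(c)], and the layer-cake formula turns orthogonality into ∫₀¹
(C(u,p(c)) − min(u,p(c))) dc = 0. Hence p(c) is a diagonal fixed point for almost every c, and g can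
drop only across fixed points (`IsCopula.eq_of_no_diag_fixedPoint`). An increasing g is replaced by
1 − g.

On a gap (a,b) between fixed points the sections are therefore affine, and their boundary values
force a rescaled Π (`IsCopula.eq_of_gap`). A fixed point between u and v forces C(u,v) = min(u,v).

Conversely, each section of an ordinal sum of Π is a convex combination of min(·,a) and min(·,b)
with a, b fixed points (`IsOrdinalSumOf.exists_section_eq`). Idempotence and the left-derivative
identity are linear in the section, so both reduce to min. Transposition handles the second
component. -/

namespace IsCopula

variable {C : ℝ → ℝ → ℝ}

/-! ### Monotonicity, Lipschitz bounds and diagonal fixed points -/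

theorem transpose (hC : IsCopula C) : IsCopula (fun u v => C v u) where
  zero_left := hC.zero_right
  zero_right := hC.zero_left
  one_left := hC.one_right
  one_right := hC.one_left
  two_increasing u₁ hu₁ u₂ hu₂ v₁ hv₁ v₂ hv₂ hu hv := by
    linarith [hC.two_increasing v₁ hv₁ v₂ hv₂ u₁ hu₁ u₂ hu₂ hv hu]

theorem mono_right (hC : IsCopula C) {u s t : ℝ} (hu : u ∈ Icc (0 : ℝ) 1)
    (hs : s ∈ Icc (0 : ℝ) 1) (ht : t ∈ Icc (0 : ℝ) 1) (hst : s ≤ t) : C u s ≤ C u t := by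
  have h0 : (0 : ℝ) ∈ Icc (0 : ℝ) 1 := by simp
  linarith [hC.two_increasing 0 h0 u hu s hs t ht hu.1 hst, hC.zero_left s hs, hC.zero_left t ht]

theorem sub_le_right (hC : IsCopula C) {u s t : ℝ} (hu : u ∈ Icc (0 : ℝ) 1)
    (hs : s ∈ Icc (0 : ℝ) 1) (ht : t ∈ Icc (0 : ℝ) 1) (hst : s ≤ t) :
    C u t - C u s ≤ t - s := by
  have h1 : (1 : ℝ) ∈ Icc (0 : ℝ) 1 := by simp
  linarith [hC.two_increasing u hu 1 h1 s hs t ht hu.2 hst, hC.one_left s hs, hC.one_left t ht]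

theorem mono_left (hC : IsCopula C) {v s t : ℝ} (hv : v ∈ Icc (0 : ℝ) 1)
    (hs : s ∈ Icc (0 : ℝ) 1) (ht : t ∈ Icc (0 : ℝ) 1) (hst : s ≤ t) : C s v ≤ C t v :=
  hC.transpose.mono_right hv hs ht hst

theorem sub_le_left (hC : IsCopula C) {v s t : ℝ} (hv : v ∈ Icc (0 : ℝ) 1)
    (hs : s ∈ Icc (0 : ℝ) 1) (ht : t ∈ Icc (0 : ℝ) 1) (hst : s ≤ t) :
    C t v - C s v ≤ t - s :=
  hC.transpose.sub_le_right hv hs ht hst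

theorem le_min (hC : IsCopula C) {u v : ℝ} (hu : u ∈ Icc (0 : ℝ) 1) (hv : v ∈ Icc (0 : ℝ) 1) :
    C u v ≤ min u v := by
  have h1 : (1 : ℝ) ∈ Icc (0 : ℝ) 1 := by simp
  apply _root_.le_min
  · exact (hC.mono_right hu hv h1 hv.2).trans_eq (hC.one_right u hu)
  · exact (hC.mono_left hv hu h1 hu.2).trans_eq (hC.one_left v hv)

theorem lipschitzOnWith_right (hC : IsCopula C) {u : ℝ} (hu : u ∈ Icc (0 : ℝ) 1) :
    LipschitzOnWith 1 (C u) (Icc 0 1) := by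
  refine LipschitzOnWith.of_le_add fun s hs t ht => ?_
  rw [Real.dist_eq]
  rcases le_total s t with h | h
  · linarith [hC.mono_right hu hs ht h, abs_nonneg (s - t)]
  · linarith [hC.sub_le_right hu ht hs h, le_abs_self (s - t)]

theorem absolutelyContinuous_right (hC : IsCopula C) {u s t : ℝ} (hu : u ∈ Icc (0 : ℝ) 1)
    (hs : s ∈ Icc (0 : ℝ) 1) (ht : t ∈ Icc (0 : ℝ) 1) :
    AbsolutelyContinuousOnInterval (C u) s t :=
  ((hC.lipschitzOnWith_right hu).mono (uIcc_subset_Icc hs ht)).absolutelyContinuousOnInterval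

theorem integral_deriv_right (hC : IsCopula C) {u s t : ℝ} (hu : u ∈ Icc (0 : ℝ) 1)
    (hs : s ∈ Icc (0 : ℝ) 1) (ht : t ∈ Icc (0 : ℝ) 1) :
    ∫ x in s..t, deriv (C u) x = C u t - C u s :=
  (hC.absolutelyContinuous_right hu hs ht).integral_deriv_eq_sub

theorem intervalIntegrable_deriv_right (hC : IsCopula C) {u s t : ℝ} (hu : u ∈ Icc (0 : ℝ) 1)
    (hs : s ∈ Icc (0 : ℝ) 1) (ht : t ∈ Icc (0 : ℝ) 1) :
    IntervalIntegrable (deriv (C u)) volume s t :=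
  (hC.absolutelyContinuous_right hu hs ht).intervalIntegrable_deriv

theorem deriv_right_mem_Icc (hC : IsCopula C) {u t : ℝ} (hu : u ∈ Icc (0 : ℝ) 1)
    (ht : t ∈ Ioo (0 : ℝ) 1) : deriv (C u) t ∈ Icc (0 : ℝ) 1 := by
  have hn : Icc (0 : ℝ) 1 ∈ nhds t := Icc_mem_nhds ht.1 ht.2
  constructor
  · rw [← derivWithin_of_mem_nhds hn]
    exact MonotoneOn.derivWithin_nonneg fun s hs r hr h => hC.mono_right hu hs hr h
  · have := norm_deriv_le_of_lipschitzOn hn (hC.lipschitzOnWith_right hu)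
    exact (le_abs_self _).trans (by simpa using this)

/-- A fixed point `p` of the diagonal section makes the sections through `p` extremal. -/
theorem eq_min_of_diag (hC : IsCopula C) {u p : ℝ} (hu : u ∈ Icc (0 : ℝ) 1)
    (hp : p ∈ Icc (0 : ℝ) 1) (h : C p p = p) : C u p = min u p := by
  refine le_antisymm (hC.le_min hu hp) ?_
  rcases le_total u p with hup | hup
  · rw [min_eq_left hup]
    linarith [hC.sub_le_left hp hu hp hup]
  · rw [min_eq_right hup]
    linarith [hC.mono_left hp hp hu hup]

theorem eq_min_of_between (hC : IsCopula C) {u v p : ℝ} (hu : u ∈ Icc (0 : ℝ) 1)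
    (hv : v ∈ Icc (0 : ℝ) 1) (h : C p p = p) (hup : u ≤ p) (hpv : p ≤ v) :
    C u v = u := by
  have hp : p ∈ Icc (0 : ℝ) 1 := ⟨hu.1.trans hup, hpv.trans hv.2⟩
  refine le_antisymm ((hC.le_min hu hv).trans (min_le_left _ _)) ?_
  have := hC.eq_min_of_diag hu hp h
  rw [min_eq_left hup] at this
  linarith [hC.mono_right hu hp hv hpv]

end IsCopula

/-! ### Transposition and the independence copula -/

theorem markovProduct_transpose (C₁ C₂ : ℝ → ℝ → ℝ) (u v : ℝ) :
    markovProduct (fun x y => C₂ y x) (fun x y => C₁ y x) u v = markovProduct C₁ C₂ v u := by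
  unfold markovProduct
  exact intervalIntegral.integral_congr fun t _ => mul_comm _ _

theorem IsMarkovIdempotent.transpose {C : ℝ → ℝ → ℝ} (h : IsMarkovIdempotent C) :
    IsMarkovIdempotent fun u v => C v u := fun u hu v hv => by
  rw [markovProduct_transpose]
  exact h v hv u hu

theorem IsOrdinalSumOf.transpose {D C : ℝ → ℝ → ℝ} (h : IsOrdinalSumOf D C) :
    IsOrdinalSumOf (fun u v => D v u) fun u v => C v u := by
  obtain ⟨ι, a, b, h⟩ := h
  refine ⟨ι, a, b, h.countable, h.nonneg, h.lt, h.le_one, h.disjoint,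
    fun k => (h.copula k).transpose, fun k u hu v hv => h.eq_inside k v hv u hu, ?_⟩
  intro u hu v hv hn
  rw [h.eq_outside v hv u hu fun ⟨k, hk⟩ => hn ⟨k, hk.symm⟩, upperFrechet, upperFrechet, min_comm]

theorem isCopula_independenceCopula : IsCopula independenceCopula where
  zero_left v _ := zero_mul v
  zero_right u _ := mul_zero u
  one_left v _ := one_mul v
  one_right u _ := mul_one u
  two_increasing u₁ _ u₂ _ v₁ _ v₂ _ hu hv := by
    have : 0 ≤ (u₂ - u₁) * (v₂ - v₁) := mul_nonneg (sub_nonneg.2 hu) (sub_nonneg.2 hv)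
    simp only [independenceCopula]
    linarith

theorem isOrdinalSumOf_independenceCopula_transpose {C : ℝ → ℝ → ℝ}
    (h : IsOrdinalSumOf independenceCopula C) :
    IsOrdinalSumOf independenceCopula fun u v => C v u := by
  have : (fun u v => independenceCopula v u) = independenceCopula := by
    funext u v
    exact mul_comm v u
  exact this ▸ h.transpose

theorem eq_independenceCopula_of_isOrdinalSum_unit {C : ℝ → ℝ → ℝ} (hC : IsCopula C)
    (h : ∀ u ∈ Ioo (0 : ℝ) 1, ∀ v ∈ Ioo (0 : ℝ) 1, C u v = u * v) :
    ∀ u ∈ Icc (0 : ℝ) 1, ∀ v ∈ Icc (0 : ℝ) 1, C u v = independenceCopula u v := by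
  intro u hu v hv
  unfold independenceCopula
  rcases hu.1.eq_or_lt with rfl | hu0
  · rw [hC.zero_left v hv, zero_mul]
  rcases hu.2.eq_or_lt with rfl | hu1
  · rw [hC.one_left v hv, one_mul]
  rcases hv.1.eq_or_lt with rfl | hv0
  · rw [hC.zero_right u hu, mul_zero]
  rcases hv.2.eq_or_lt with rfl | hv1
  · rw [hC.one_right u hu, mul_one]
  exact h u ⟨hu0, hu1⟩ v ⟨hv0, hv1⟩

/-- A single summand on (0,1) suffices, since uv and min(u,v) agree on the boundary of the square.
-/
theorem isOrdinalSumOf_of_eq_independenceCopula {C : ℝ → ℝ → ℝ}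
    (h : ∀ u ∈ Icc (0 : ℝ) 1, ∀ v ∈ Icc (0 : ℝ) 1, C u v = independenceCopula u v) :
    IsOrdinalSumOf independenceCopula C := by
  refine ⟨Unit, fun _ => 0, fun _ => 1, inferInstance, by simp, by simp, by simp, ?_,
    fun _ => isCopula_independenceCopula, ?_, ?_⟩
  · intro k l hkl
    exact absurd rfl hkl
  · intro _ u hu v hv
    simp [h u (Ioo_subset_Icc_self hu) v (Ioo_subset_Icc_self hv)]
  · intro u hu v hv hn
    rw [h u hu v hv, independenceCopula, upperFrechet]
    rcases hu.1.eq_or_lt with rfl | hu0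
    · simp [hv.1]
    rcases hu.2.eq_or_lt with rfl | hu1
    · simp [hv.2]
    rcases hv.1.eq_or_lt with rfl | hv0
    · simp [hu.1]
    rcases hv.2.eq_or_lt with rfl | hv1
    · simp [hu.2]
    exact absurd ⟨(), ⟨hu0, hu1⟩, hv0, hv1⟩ hn

/-! ### Layer-cake formula and superlevel sets of decreasing functions -/

/-- Layer-cake formula for a weight `h` against a `[0, 1]`-valued function `g`. -/
theorem integrable_superlevel_and_integral_mul_eq {h g : ℝ → ℝ}
    (hh : IntegrableOn h (Ioc 0 1)) (hg : Measurable g)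
    (hg01 : ∀ᵐ t ∂volume.restrict (Ioc (0 : ℝ) 1), g t ∈ Icc (0 : ℝ) 1) :
    IntegrableOn (fun c => ∫ t in Ioc (0 : ℝ) 1, {t | c < g t}.indicator h t) (Ioc 0 1) ∧
    ∫ t in Ioc (0 : ℝ) 1, h t * g t =
      ∫ c in Ioc (0 : ℝ) 1, ∫ t in Ioc (0 : ℝ) 1, {t | c < g t}.indicator h t := by
  set μ := volume.restrict (Ioc (0 : ℝ) 1)
  have hmeas : MeasurableSet {x : ℝ × ℝ | x.2 < g x.1} :=
    measurableSet_lt measurable_snd (hg.comp measurable_fst)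
  have hint : Integrable (Function.uncurry fun t c : ℝ => {t | c < g t}.indicator h t)
      (μ.prod μ) := by
    have := (hh.comp_fst (ν := μ)).indicator hmeas
    refine this.congr (Filter.Eventually.of_forall fun x => ?_)
    simp [Function.uncurry, indicator]
  refine ⟨hint.integral_prod_right, ?_⟩
  rw [← integral_integral_swap hint]
  refine integral_congr_ae ?_
  filter_upwards [hg01] with t ht
  -- For fixed t, the integral over c is h(t) times the length g(t) of the set of c in (0,1] below
  -- g(t).
  have hfun : (fun c => {t | c < g t}.indicator h t) = (Iio (g t)).indicator fun _ => h t := by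
    funext c
    simp [indicator]
  rw [hfun, integral_indicator measurableSet_Iio, Measure.restrict_restrict measurableSet_Iio,
    integral_const, smul_eq_mul, mul_comm]
  congr 1
  have hIoo : (Iio (g t) ∩ Ioc 0 1 : Set ℝ) =ᵐ[volume] (Ioc 0 (g t) : Set ℝ) := by
    have : Iio (g t) ∩ Ioc 0 1 = Ioo 0 (g t) := by
      ext c
      simp only [mem_inter_iff, mem_Iio, mem_Ioc, mem_Ioo]
      exact ⟨fun h => ⟨h.2.1, h.1⟩, fun h => ⟨h.2, h.1, h.2.le.trans ht.2⟩⟩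
    rw [this]
    exact Ioo_ae_eq_Ioc
  rw [measureReal_restrict_apply_univ, measureReal_congr hIoo, Real.volume_real_Ioc_of_le ht.1,
    sub_zero]

/-- The end point of the initial interval on which the decreasing function `g` exceeds `c`. -/
noncomputable def superlevelEnd (N : Set ℝ) (g : ℝ → ℝ) (c : ℝ) : ℝ :=
  sSup {t ∈ Ioo (0 : ℝ) 1 \ N | c < g t}

theorem le_superlevelEnd {N : Set ℝ} {g : ℝ → ℝ} {c t : ℝ} (ht : t ∈ Ioo (0 : ℝ) 1 \ N)
    (hc : c < g t) : t ≤ superlevelEnd N g c :=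
  le_csSup ⟨1, fun _ hs => hs.1.1.2.le⟩ ⟨ht, hc⟩

theorem superlevelEnd_le {N : Set ℝ} {g : ℝ → ℝ} (hanti : AntitoneOn g (Ioo (0 : ℝ) 1 \ N))
    {c t : ℝ} (ht : t ∈ Ioo (0 : ℝ) 1 \ N) (hc : g t ≤ c) : superlevelEnd N g c ≤ t := by
  -- The superlevel set may be empty; its supremum is then 0, which is at most t.
  refine Real.sSup_le (fun s hs => ?_) ht.1.1.le
  by_contra hlt
  linarith [hanti ht hs.1 (not_le.1 hlt).le, hs.2]

theorem superlevelEnd_mem_Icc (N : Set ℝ) (g : ℝ → ℝ) (c : ℝ) :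
    superlevelEnd N g c ∈ Icc (0 : ℝ) 1 :=
  ⟨Real.sSup_nonneg fun _ hs => hs.1.1.1.le, Real.sSup_le (fun _ hs => hs.1.1.2.le) zero_le_one⟩

/-- By monotonicity off N, the superlevel set and (0, `superlevelEnd N g c`] differ only in a null
set: points of N, the point 1 and the end point itself. -/
theorem integral_superlevel_indicator {N : Set ℝ} (hN : volume N = 0) {h g : ℝ → ℝ}
    (hg : Measurable g) (hanti : AntitoneOn g (Ioo (0 : ℝ) 1 \ N)) (c : ℝ) :
    ∫ t in Ioc (0 : ℝ) 1, {t | c < g t}.indicator h t =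
      ∫ t in (0 : ℝ)..superlevelEnd N g c, h t := by
  have hp := superlevelEnd_mem_Icc N g c
  have hms : MeasurableSet {t | c < g t} := measurableSet_lt measurable_const hg
  rw [integral_indicator hms, Measure.restrict_restrict hms,
    intervalIntegral.integral_of_le hp.1]
  refine setIntegral_congr_set ?_
  have hNae : ∀ᵐ t : ℝ, t ∉ N := measure_eq_zero_iff_ae_notMem.1 hN
  have h1 : ∀ᵐ t : ℝ, t ≠ 1 := by simp [ae_iff]
  have h2 : ∀ᵐ t : ℝ, t ≠ superlevelEnd N g c := by simp [ae_iff]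
  filter_upwards [hNae, h1, h2] with t htN ht1 htp
  refine propext ⟨fun ⟨hc, ht⟩ => ?_, fun ht => ?_⟩
  · exact ⟨ht.1, le_superlevelEnd ⟨⟨ht.1, lt_of_le_of_ne ht.2 ht1⟩, htN⟩ hc⟩
  · have htI : t ∈ Ioc (0 : ℝ) 1 := ⟨ht.1, ht.2.trans hp.2⟩
    refine ⟨?_, htI⟩
    by_contra hc
    exact htp (le_antisymm ht.2
      (superlevelEnd_le hanti ⟨⟨ht.1, lt_of_le_of_ne htI.2 ht1⟩, htN⟩ (not_lt.1 hc)))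

/-- If `h` has nonpositive primitive vanishing on the average against a decreasing function `g`,
then the primitive vanishes at almost all end points of superlevel sets of `g`. -/
theorem ae_integral_superlevelEnd_eq_zero {N : Set ℝ} (hN : volume N = 0) {h g : ℝ → ℝ}
    (hh : IntegrableOn h (Ioc 0 1)) (hg : Measurable g)
    (hg01 : ∀ t ∈ Ioo (0 : ℝ) 1, g t ∈ Icc (0 : ℝ) 1)
    (hanti : AntitoneOn g (Ioo (0 : ℝ) 1 \ N))
    (hH : ∀ s ∈ Icc (0 : ℝ) 1, ∫ t in (0 : ℝ)..s, h t ≤ 0)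
    (h0 : ∫ t in (0 : ℝ)..1, h t * g t = 0) :
    ∀ᵐ c ∂volume.restrict (Ioc (0 : ℝ) 1), ∫ t in (0 : ℝ)..superlevelEnd N g c, h t = 0 := by
  have hae : ∀ᵐ t ∂volume.restrict (Ioc (0 : ℝ) 1), g t ∈ Icc (0 : ℝ) 1 := by
    rw [← restrict_Ioo_eq_restrict_Ioc]
    exact ae_restrict_of_forall_mem measurableSet_Ioo hg01
  obtain ⟨hint, heq⟩ := integrable_superlevel_and_integral_mul_eq hh hg hae
  simp only [integral_superlevel_indicator hN hg hanti] at hint heq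
  rw [intervalIntegral.integral_of_le zero_le_one, heq, ← neg_eq_zero, ← integral_neg] at h0
  have hnn : 0 ≤ fun c => -∫ t in (0 : ℝ)..superlevelEnd N g c, h t := fun c => by
    simpa using hH _ (superlevelEnd_mem_Icc N g c)
  filter_upwards [(integral_eq_zero_iff_of_nonneg hnn hint.neg).1 h0] with c hc
  simpa using hc

/-! ### Constancy of the slope between diagonal fixed points -/

/-- Main step: a decreasing function which integrates to the same value against `∂₂C(u, ·)` and
against the indicator of `[0, u]`, for all `u`, is constant on every interval free of fixed points
of the diagonal section. -/
theorem IsCopula.eq_of_no_diag_fixedPoint {C : ℝ → ℝ → ℝ} (hC : IsCopula C) {N : Set ℝ}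
    (hN : volume N = 0) {g : ℝ → ℝ} (hg : Measurable g)
    (hg01 : ∀ t ∈ Ioo (0 : ℝ) 1, g t ∈ Icc (0 : ℝ) 1)
    (hanti : AntitoneOn g (Ioo (0 : ℝ) 1 \ N))
    (hint : ∀ u ∈ Icc (0 : ℝ) 1,
      ∫ t in (0 : ℝ)..1, deriv (C u) t * g t = ∫ t in (0 : ℝ)..u, g t)
    {x y : ℝ} (hx : x ∈ Ioo (0 : ℝ) 1 \ N) (hy : y ∈ Ioo (0 : ℝ) 1 \ N) (hxy : x ≤ y)
    (hP : ∀ p ∈ Icc x y, C p p ≠ p) : g x = g y := by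
  have h0 : (0 : ℝ) ∈ Icc (0 : ℝ) 1 := by simp
  have h1 : (1 : ℝ) ∈ Icc (0 : ℝ) 1 := by simp
  by_contra hne
  have hlt : g y < g x := lt_of_le_of_ne (hanti hx hy hxy) (Ne.symm hne)
  have hgi : IntervalIntegrable g volume 0 1 := by
    rw [intervalIntegrable_iff_integrableOn_Ioo_of_le zero_le_one]
    refine IntegrableOn.of_bound (by simp) hg.aestronglyMeasurable 1 ?_
    refine ae_restrict_of_forall_mem measurableSet_Ioo fun t ht => ?_
    rw [Real.norm_eq_abs, abs_of_nonneg (hg01 t ht).1]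
    exact (hg01 t ht).2
  -- The weight is ∂₂C(u,·) − 1_(−∞,u], whose primitive from 0 is C(u,s) − min(u,s) ≤ 0.
  have key : ∀ u ∈ Icc (0 : ℝ) 1, ∀ᵐ c ∂volume.restrict (Ioc (0 : ℝ) 1),
      C u (superlevelEnd N g c) = min u (superlevelEnd N g c) := by
    intro u hu
    have hiu : IntegrableOn ((Iic u).indicator fun _ => (1 : ℝ)) (Ioc 0 1) :=
      (integrable_const (1 : ℝ)).indicator measurableSet_Iic
    have hdi := hC.intervalIntegrable_deriv_right hu h0 h1
    have hindic : ∀ s ∈ Icc (0 : ℝ) 1, ∀ f : ℝ → ℝ,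
        ∫ t in (0 : ℝ)..s, (Iic u).indicator (fun _ => (1 : ℝ)) t * f t =
          ∫ t in (0 : ℝ)..min u s, f t := by
      intro s hs f
      have : (fun t => (Iic u).indicator (fun _ => (1 : ℝ)) t * f t) = (Iic u).indicator f := by
        funext t
        by_cases ht : t ≤ u <;> simp [indicator, ht]
      rw [this, intervalIntegral.integral_of_le hs.1, integral_indicator measurableSet_Iic,
        Measure.restrict_restrict measurableSet_Iic, inter_comm, Ioc_inter_Iic,
        intervalIntegral.integral_of_le (_root_.le_min hu.1 hs.1), inf_comm]
    have hprim : ∀ s ∈ Icc (0 : ℝ) 1,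
        ∫ t in (0 : ℝ)..s, (deriv (C u) t - (Iic u).indicator (fun _ => (1 : ℝ)) t) =
          C u s - min u s := by
      intro s hs
      have hii : IntervalIntegrable ((Iic u).indicator fun _ => (1 : ℝ)) volume 0 s := by
        rw [intervalIntegrable_iff_integrableOn_Ioc_of_le hs.1]
        exact hiu.mono_set (Ioc_subset_Ioc_right hs.2)
      have h1s := hindic s hs fun _ => 1
      simp only [mul_one, intervalIntegral.integral_const, sub_zero, smul_eq_mul] at h1s
      rw [intervalIntegral.integral_sub (hC.intervalIntegrable_deriv_right hu h0 hs) hii,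
        hC.integral_deriv_right hu h0 hs, hC.zero_right u hu, h1s, sub_zero]
    have := ae_integral_superlevelEnd_eq_zero hN
      (h := fun t => deriv (C u) t - (Iic u).indicator (fun _ => (1 : ℝ)) t)
      (((intervalIntegrable_iff_integrableOn_Ioc_of_le zero_le_one).1 hdi).sub hiu) hg hg01 hanti
      (fun s hs => by rw [hprim s hs]; linarith [hC.le_min hu hs]) ?_
    · filter_upwards [this] with c hc
      rw [hprim _ (superlevelEnd_mem_Icc N g c)] at hc
      linarith
    · have hbd : ∀ᵐ t ∂volume.restrict (Ioc (0 : ℝ) 1), ‖g t‖ ≤ 1 := by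
        rw [← restrict_Ioo_eq_restrict_Ioc]
        refine ae_restrict_of_forall_mem measurableSet_Ioo fun t ht => ?_
        rw [Real.norm_eq_abs, abs_of_nonneg (hg01 t ht).1]
        exact (hg01 t ht).2
      have e1 : IntervalIntegrable (fun t => deriv (C u) t * g t) volume 0 1 := by
        rw [intervalIntegrable_iff_integrableOn_Ioc_of_le zero_le_one] at hdi ⊢
        exact hdi.mul_bdd hg.aestronglyMeasurable hbd
      have e2 : IntervalIntegrable
          (fun t => (Iic u).indicator (fun _ => (1 : ℝ)) t * g t) volume 0 1 := by
        rw [intervalIntegrable_iff_integrableOn_Ioc_of_le zero_le_one]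
        exact Integrable.mul_bdd hiu hg.aestronglyMeasurable hbd
      simp only [sub_mul]
      rw [intervalIntegral.integral_sub e1 e2, hint u hu, hindic 1 h1, min_eq_left hu.2, sub_self]
  -- The exceptional null set in `key` depends on u; countably many u allow one common null set.
  have keyQ : ∀ᵐ c ∂volume.restrict (Ioc (0 : ℝ) 1), ∀ q : ℚ, (q : ℝ) ∈ Icc (0 : ℝ) 1 →
      C q (superlevelEnd N g c) = min (q : ℝ) (superlevelEnd N g c) := by
    rw [ae_all_iff]
    intro q
    by_cases hq : (q : ℝ) ∈ Icc (0 : ℝ) 1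
    · filter_upwards [key q hq] with c hc _
      exact hc
    · exact Filter.Eventually.of_forall fun c h => absurd h hq
  -- The levels between g(y) and g(x) have positive measure, so one of them is good for all
  -- rationals; its end point lies in [x,y].
  have hsub : Ioo (g y) (g x) ⊆ Ioc 0 1 := fun c hc =>
    ⟨(hg01 y hy.1).1.trans_lt hc.1, hc.2.le.trans (hg01 x hx.1).2⟩
  have hae := ae_restrict_of_ae_restrict_of_subset hsub keyQ
  have hne : (ae (volume.restrict (Ioo (g y) (g x)))).NeBot := by
    rw [ae_neBot, Ne, Measure.restrict_eq_zero, Real.volume_Ioo]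
    simpa using hlt
  obtain ⟨c, hc, hcI⟩ := (hae.and (ae_restrict_mem measurableSet_Ioo)).exists
  set p := superlevelEnd N g c
  have hxp : x ≤ p := le_superlevelEnd hx hcI.2
  have hpy : p ≤ y := superlevelEnd_le hanti hy hcI.1.le
  have hp : p ∈ Icc (0 : ℝ) 1 := superlevelEnd_mem_Icc N g c
  refine hP p ⟨hxp, hpy⟩ (le_antisymm ((hC.le_min hp hp).trans (min_le_left _ _)) ?_)
  -- For rational q in [0,p), q = C(q,p) ≤ C(p,p).
  refine le_of_forall_rat_lt_imp_le fun q hq => ?_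
  rcases le_total (q : ℝ) 0 with hq0 | hq0
  · exact hq0.trans ((hC.zero_right p hp).symm.le.trans (hC.mono_right hp h0 hp hp.1))
  · have hqI : (q : ℝ) ∈ Icc (0 : ℝ) 1 := ⟨hq0, hq.le.trans hp.2⟩
    have := hc q hqI
    rw [min_eq_left hq.le] at this
    exact this.symm.le.trans (hC.mono_left hp hqI hp hq.le)

/-- Sections of an idempotent stochastically monotone copula have constant slope on intervals
free of fixed points of the diagonal section. -/
theorem IsCopula.exists_deriv_eq {C : ℝ → ℝ → ℝ} (hC : IsCopula C)
    (hmono : StochMonotone C 0) (hidem : IsMarkovIdempotent C) {a b v : ℝ} (ha : 0 ≤ a)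
    (hb : b ≤ 1) (hP : ∀ p ∈ Ioo a b, C p p ≠ p) (hv : v ∈ Icc (0 : ℝ) 1) :
    ∃ N : Set ℝ, volume N = 0 ∧ ∀ x ∈ Ioo a b \ N, ∀ y ∈ Ioo a b \ N,
      deriv (fun s => C s v) x = deriv (fun s => C s v) y := by
  have h0 : (0 : ℝ) ∈ Icc (0 : ℝ) 1 := by simp
  have h1 : (1 : ℝ) ∈ Icc (0 : ℝ) 1 := by simp
  set f := deriv fun s => C s v with hf
  have hfm : Measurable f := measurable_deriv _
  have hf01 : ∀ t ∈ Ioo (0 : ℝ) 1, f t ∈ Icc (0 : ℝ) 1 := fun t ht =>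
    hC.transpose.deriv_right_mem_Icc hv ht
  have hfI : ∀ u ∈ Icc (0 : ℝ) 1, ∫ t in (0 : ℝ)..u, f t = C u v := fun u hu => by
    rw [hf, hC.transpose.integral_deriv_right hv h0 hu, hC.zero_left v hv, sub_zero]
  have hfint : ∀ u ∈ Icc (0 : ℝ) 1, ∫ t in (0 : ℝ)..1, deriv (C u) t * f t =
      ∫ t in (0 : ℝ)..u, f t := fun u hu => by
    rw [hfI u hu]
    exact hidem u hu v hv
  have hIoo : Ioo a b ⊆ Ioo 0 1 := Ioo_subset_Ioo ha hb
  have wlog_le : ∀ (g : ℝ → ℝ) (N : Set ℝ), (∀ x ∈ Ioo a b \ N, ∀ y ∈ Ioo a b \ N, x ≤ y →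
      g x = g y) → ∀ x ∈ Ioo a b \ N, ∀ y ∈ Ioo a b \ N, g x = g y := by
    intro g N h x hx y hy
    rcases le_total x y with hxy | hxy
    · exact h x hx y hy hxy
    · exact (h y hy x hx hxy).symm
  rcases hmono with hI | hD
  · obtain ⟨N, hN, -, hanti⟩ := hI v hv
    refine ⟨N, hN, wlog_le _ _ fun x hx y hy hxy => ?_⟩
    exact hC.eq_of_no_diag_fixedPoint hN hfm hf01 hanti hfint ⟨hIoo hx.1, hx.2⟩
      ⟨hIoo hy.1, hy.2⟩ hxy fun p hp => hP p ⟨hx.1.1.trans_le hp.1, hp.2.trans_lt hy.1.2⟩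
  · obtain ⟨N, hN, -, hmon⟩ := hD v hv
    replace hmon : MonotoneOn f (Ioo 0 1 \ N) := hmon
    refine ⟨N, hN, wlog_le _ _ fun x hx y hy hxy => ?_⟩
    -- The integral identity passes from f to 1 − f because it also holds for the constant 1: ∫₀¹
    -- ∂₂C(u,t) dt = u.
    have := hC.eq_of_no_diag_fixedPoint (g := fun t => 1 - f t) hN (measurable_const.sub hfm)
      (fun t ht => ⟨by linarith [(hf01 t ht).2], by linarith [(hf01 t ht).1]⟩)
      (fun s hs t ht hst => by linarith [hmon hs ht hst]) ?_ ⟨hIoo hx.1, hx.2⟩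
      ⟨hIoo hy.1, hy.2⟩ hxy fun p hp => hP p ⟨hx.1.1.trans_le hp.1, hp.2.trans_lt hy.1.2⟩
    · linarith
    · intro u hu
      have hdi := hC.intervalIntegrable_deriv_right hu h0 h1
      have hprod : IntervalIntegrable (fun t => deriv (C u) t * f t) volume 0 1 := by
        rw [intervalIntegrable_iff_integrableOn_Ioo_of_le zero_le_one] at hdi ⊢
        refine hdi.mul_bdd (c := 1) hfm.aestronglyMeasurable ?_
        refine ae_restrict_of_forall_mem measurableSet_Ioo fun t ht => ?_
        rw [Real.norm_eq_abs, abs_of_nonneg (hf01 t ht).1]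
        exact (hf01 t ht).2
      have hfi : IntervalIntegrable f volume 0 u :=
        hC.transpose.intervalIntegrable_deriv_right hv h0 hu
      simp only [mul_sub, mul_one]
      rw [intervalIntegral.integral_sub hdi hprod, hfint u hu,
        hC.integral_deriv_right hu h0 h1,
        intervalIntegral.integral_sub intervalIntegrable_const hfi, hC.one_right u hu,
        hC.zero_right u hu]
      simp

/-- The section C(·,v) is affine on [a,b], and the fixed points a, b give its boundary values C(a,v)
= a and C(b,v) = v. -/
theorem IsCopula.eq_of_gap {C : ℝ → ℝ → ℝ} (hC : IsCopula C)
    (hmono : StochMonotone C 0) (hidem : IsMarkovIdempotent C) {a b u v : ℝ} (ha0 : 0 ≤ a)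
    (hb1 : b ≤ 1) (ha : C a a = a) (hb : C b b = b) (hP : ∀ p ∈ Ioo a b, C p p ≠ p)
    (hu : u ∈ Ioo a b) (hv : v ∈ Ioo a b) :
    C u v = a + (u - a) * (v - a) / (b - a) := by
  have hab : a < b := hu.1.trans hu.2
  have haI : a ∈ Icc (0 : ℝ) 1 := ⟨ha0, hab.le.trans hb1⟩
  have hbI : b ∈ Icc (0 : ℝ) 1 := ⟨ha0.trans hab.le, hb1⟩
  have huI : u ∈ Icc (0 : ℝ) 1 := ⟨ha0.trans hu.1.le, hu.2.le.trans hb1⟩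
  have hvI : v ∈ Icc (0 : ℝ) 1 := ⟨ha0.trans hv.1.le, hv.2.le.trans hb1⟩
  obtain ⟨N, hN, hconst⟩ := hC.exists_deriv_eq hmono hidem ha0 hb1 hP hvI
  have hNae : ∀ᵐ t : ℝ, t ∉ N := measure_eq_zero_iff_ae_notMem.1 hN
  obtain ⟨κ, hκ⟩ : ∃ κ, ∀ x ∈ Ioo a b \ N, deriv (fun s => C s v) x = κ := by
    by_cases hne : (Ioo a b \ N).Nonempty
    · obtain ⟨y, hy⟩ := hne
      exact ⟨_, fun x hx => hconst x hx y hy⟩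
    -- Here the claim is vacuous, so any κ serves.
    · exact ⟨0, fun x hx => absurd ⟨x, hx⟩ hne⟩
  have haff : ∀ s ∈ Ioc a b, C s v - C a v = κ * (s - a) := by
    intro s hs
    have hsI : s ∈ Icc (0 : ℝ) 1 := ⟨ha0.trans hs.1.le, hs.2.trans hb1⟩
    rw [← hC.transpose.integral_deriv_right hvI haI hsI]
    have : ∫ x in a..s, deriv (fun t => C t v) x = ∫ x in a..s, κ := by
      refine intervalIntegral.integral_congr_ae ?_
      have hb' : ∀ᵐ t : ℝ, t ≠ b := by simp [ae_iff]
      filter_upwards [hNae, hb'] with t ht htb hts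
      rw [uIoc_of_le hs.1.le] at hts
      exact hκ t ⟨⟨hts.1, lt_of_le_of_ne (hts.2.trans hs.2) htb⟩, ht⟩
    rw [this, intervalIntegral.integral_const, smul_eq_mul, mul_comm]
  have hCa : C a v = a := hC.eq_min_of_between haI ⟨hvI.1, hvI.2⟩ ha le_rfl hv.1.le
  have hCb : C b v = v := hC.transpose.eq_min_of_between hvI hbI hb hv.2.le le_rfl
  have e1 := haff u ⟨hu.1, hu.2.le⟩
  have e2 := haff b ⟨hab, le_rfl⟩
  rw [hCa] at e1 e2
  rw [hCb] at e2
  have hne : b - a ≠ 0 := (sub_pos.2 hab).ne'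
  rw [e2, mul_div_assoc, mul_div_assoc, div_self hne, mul_one]
  linarith

/-! ### From gaps of the fixed-point set to an ordinal sum -/

theorem IsCopula.isClosed_diag_fixedPoints {C : ℝ → ℝ → ℝ} (hC : IsCopula C) :
    IsClosed {p ∈ Icc (0 : ℝ) 1 | C p p = p} := by
  have hL : LipschitzOnWith 2 (fun p => C p p) (Icc 0 1) := by
    refine LipschitzOnWith.of_le_add_mul 2 fun s hs t ht => ?_
    rw [Real.dist_eq]
    push_cast
    rcases le_total s t with h | h
    · linarith [hC.mono_right hs hs ht h, hC.mono_left ht hs ht h, abs_nonneg (s - t)]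
    · linarith [hC.sub_le_right hs ht hs h, hC.sub_le_left ht ht hs h, le_abs_self (s - t)]
  exact isClosed_Icc.isClosed_eq hL.continuousOn continuousOn_id

/-- A point outside a closed set `S`, between two of its points, lies in a gap of `S`. -/
theorem exists_gap {S : Set ℝ} (hS : IsClosed S) {x y z : ℝ} (hy : y ∈ S) (hz : z ∈ S)
    (hyx : y ≤ x) (hxz : x ≤ z) (hx : x ∉ S) :
    ∃ a ∈ S, ∃ b ∈ S, x ∈ Ioo a b ∧ ∀ p ∈ Ioo a b, p ∉ S := by
  have hbdd : BddAbove (S ∩ Iic x) := ⟨x, fun p hp => hp.2⟩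
  have hbdd' : BddBelow (S ∩ Ici x) := ⟨x, fun p hp => hp.2⟩
  have ha := (hS.inter isClosed_Iic).csSup_mem ⟨y, hy, hyx⟩ hbdd
  have hb := (hS.inter isClosed_Ici).csInf_mem ⟨z, hz, hxz⟩ hbdd'
  refine ⟨_, ha.1, _, hb.1, ⟨lt_of_le_of_ne ha.2 ?_, lt_of_le_of_ne hb.2 ?_⟩, ?_⟩
  · intro h
    exact hx (h ▸ ha.1)
  · intro h
    exact hx (h ▸ hb.1)
  · intro p hp hpS
    rcases le_total p x with h | h
    · exact hp.1.not_ge (le_csSup hbdd ⟨hpS, h⟩)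
    · exact hp.2.not_ge (csInf_le hbdd' ⟨hpS, h⟩)

theorem IsCopula.isOrdinalSumOf {C : ℝ → ℝ → ℝ} (hC : IsCopula C)
    (hmono : StochMonotone C 0) (hidem : IsMarkovIdempotent C) :
    IsOrdinalSumOf independenceCopula C := by
  have h0 : (0 : ℝ) ∈ Icc (0 : ℝ) 1 := by simp
  have h1 : (1 : ℝ) ∈ Icc (0 : ℝ) 1 := by simp
  set S : Set ℝ := {p ∈ Icc (0 : ℝ) 1 | C p p = p}
  have hS : IsClosed S := hC.isClosed_diag_fixedPoints
  have h0S : (0 : ℝ) ∈ S := ⟨h0, hC.zero_left 0 h0⟩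
  have h1S : (1 : ℝ) ∈ S := ⟨h1, hC.one_left 1 h1⟩
  -- The summands are indexed by the gaps of S, each given by its two end points in S.
  let ι := {q : ℝ × ℝ // q.1 < q.2 ∧ q.1 ∈ S ∧ q.2 ∈ S ∧ ∀ p ∈ Ioo q.1 q.2, p ∉ S}
  have hdisj : Pairwise fun k l : ι => Disjoint (Ioo k.1.1 k.1.2) (Ioo l.1.1 l.1.2) := by
    rintro ⟨⟨a, b⟩, hab, ha, hb, hP⟩ ⟨⟨c, d⟩, hcd, hc, hd, hQ⟩ hne
    rw [Set.disjoint_left]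
    rintro x ⟨hx1, hx2⟩ ⟨hx3, hx4⟩
    simp only at *
    refine hne (Subtype.ext (Prod.ext ?_ ?_))
    · rcases lt_trichotomy a c with h | h | h
      · exact absurd hc (hP c ⟨h, hx3.trans hx2⟩)
      · exact h
      · exact absurd ha (hQ a ⟨h, hx1.trans hx4⟩)
    · rcases lt_trichotomy b d with h | h | h
      · exact absurd hb (hQ b ⟨hx3.trans hx2, h⟩)
      · exact h
      · exact absurd hd (hP d ⟨hx1.trans hx4, h⟩)
  refine ⟨ι, fun k => k.1.1, fun k => k.1.2, ?_, fun k => k.2.2.1.1.1, fun k => k.2.1,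
    fun k => k.2.2.2.1.1.2, hdisj, fun _ => isCopula_independenceCopula, ?_, ?_⟩
  · exact hdisj.countable_of_isOpen_disjoint (fun _ => isOpen_Ioo) fun k => nonempty_Ioo.2 k.2.1
  · rintro ⟨⟨a, b⟩, hab, ha, hb, hP⟩ u hu v hv
    simp only at hab ha hb hP hu hv ⊢
    rw [hC.eq_of_gap hmono hidem ha.1.1 hb.1.2 ha.2 hb.2 (fun p hp h => hP p hp
      ⟨⟨ha.1.1.trans hp.1.le, hp.2.le.trans hb.1.2⟩, h⟩) hu hv, independenceCopula]
    have hne : b - a ≠ 0 := (sub_pos.2 hab).ne'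
    field_simp
  · intro u hu v hv hn
    -- Two points in no common gap are separated by a fixed point: x itself, or the right end of the
    -- gap containing x.
    have aux : ∀ x ∈ Icc (0 : ℝ) 1, ∀ y ∈ Icc (0 : ℝ) 1, x ≤ y →
        (¬ ∃ k : ι, x ∈ Ioo k.1.1 k.1.2 ∧ y ∈ Ioo k.1.1 k.1.2) →
        ∃ p, C p p = p ∧ x ≤ p ∧ p ≤ y := by
      intro x hx y hy hxy hno
      by_cases hxS : x ∈ S
      · exact ⟨x, hxS.2, le_rfl, hxy⟩
      obtain ⟨a, ha, b, hb, hxab, hP⟩ := exists_gap hS h0S h1S hx.1 hx.2 hxS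
      refine ⟨b, hb.2, hxab.2.le, ?_⟩
      by_contra hyb
      exact hno ⟨⟨(a, b), hxab.1.trans hxab.2, ha, hb, hP⟩, hxab, hxab.1.trans_le hxy,
        not_le.1 hyb⟩
    rw [upperFrechet]
    rcases le_total u v with h | h
    · obtain ⟨p, hp, h1, h2⟩ := aux u hu v hv h hn
      rw [min_eq_left h, hC.eq_min_of_between hu hv hp h1 h2]
    · obtain ⟨p, hp, h1, h2⟩ := aux v hv u hu h fun ⟨k, hk⟩ => hn ⟨k, hk.symm⟩
      rw [min_eq_right h]
      exact hC.transpose.eq_min_of_between hv hu hp h1 h2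

/-- A fixed point p in (0,1) would give C(s,p) = min(s,p), whose slope falls from 1 to 0 across p,
against the increasing derivative. So all of (0,1) is one gap. -/
theorem IsCopula.eq_independenceCopula_of_stochDecreasing {C : ℝ → ℝ → ℝ} (hC : IsCopula C)
    (hdec : StochDecreasing C 0) (hidem : IsMarkovIdempotent C) :
    ∀ u ∈ Icc (0 : ℝ) 1, ∀ v ∈ Icc (0 : ℝ) 1, C u v = independenceCopula u v := by
  have h0 : (0 : ℝ) ∈ Icc (0 : ℝ) 1 := by simp
  have h1 : (1 : ℝ) ∈ Icc (0 : ℝ) 1 := by simp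
  refine eq_independenceCopula_of_isOrdinalSum_unit hC fun u hu v hv => ?_
  rw [hC.eq_of_gap (Or.inr hdec) hidem le_rfl le_rfl (hC.zero_left 0 h0) (hC.one_left 1 h1)
    ?_ hu hv]
  · ring
  intro p hp hpp
  have hpI := Ioo_subset_Icc_self hp
  obtain ⟨N, hN, -, hmon⟩ := hdec p hpI
  have hNae : ∀ᵐ t : ℝ, t ∉ N := measure_eq_zero_iff_ae_notMem.1 hN
  -- Evaluation points off N are available on both sides of p.
  have hex : ∀ a b : ℝ, a < b → ∃ x ∈ Ioo a b, x ∉ N := by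
    intro a b hab
    have : (ae (volume.restrict (Ioo a b))).NeBot := by
      rw [ae_neBot, Ne, Measure.restrict_eq_zero, Real.volume_Ioo]
      simpa using hab
    obtain ⟨x, hx, hxI⟩ :=
      ((ae_restrict_of_ae hNae).and (ae_restrict_mem (μ := volume) (measurableSet_Ioo (a := a)
        (b := b)))).exists
    exact ⟨x, hxI, hx⟩
  obtain ⟨x, hx, hxN⟩ := hex 0 p hp.1
  obtain ⟨y, hy, hyN⟩ := hex p 1 hp.2
  have hle := hmon ⟨⟨hx.1, hx.2.trans hp.2⟩, hxN⟩ ⟨⟨hp.1.trans hy.1, hy.2⟩, hyN⟩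
    (hx.2.trans hy.1).le
  have hdx : deriv (fun s => C s p) x = 1 := by
    have : (fun s => C s p) =ᶠ[nhds x] id := by
      filter_upwards [Ioo_mem_nhds hx.1 hx.2] with s hs
      rw [hC.eq_min_of_diag ⟨hs.1.le, hs.2.le.trans hp.2.le⟩ hpI hpp, min_eq_left hs.2.le, id]
    rw [this.deriv_eq, deriv_id]
  have hdy : deriv (fun s => C s p) y = 0 := by
    have : (fun s => C s p) =ᶠ[nhds y] fun _ => p := by
      filter_upwards [Ioo_mem_nhds hy.1 hy.2] with s hs
      rw [hC.eq_min_of_diag ⟨hp.1.le.trans hs.1.le, hs.2.le⟩ hpI hpp, min_eq_right hs.1.le]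
    rw [this.deriv_eq, deriv_const]
  simp only [componentSection, if_true] at hle
  rw [hdx, hdy] at hle
  exact absurd hle (by norm_num)

/-! ### Sections of an ordinal sum of Π -/

theorem not_mem_Ioo_of_disjoint_left {a b c d : ℝ} (hab : a < b)
    (h : Disjoint (Ioo a b) (Ioo c d)) : a ∉ Ioo c d := fun ha => by
  obtain ⟨x, hx1, hx2⟩ := exists_between (lt_min hab ha.2)
  exact Set.disjoint_left.1 h ⟨hx1, hx2.trans_le (min_le_left _ _)⟩
    ⟨ha.1.trans hx1, hx2.trans_le (min_le_right _ _)⟩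

theorem not_mem_Ioo_of_disjoint_right {a b c d : ℝ} (hab : a < b)
    (h : Disjoint (Ioo a b) (Ioo c d)) : b ∉ Ioo c d := fun hb => by
  obtain ⟨x, hx1, hx2⟩ := exists_between (max_lt hab hb.1)
  exact Set.disjoint_left.1 h ⟨(le_max_left _ _).trans_lt hx1, hx2⟩
    ⟨(le_max_right _ _).trans_lt hx1, hx2.trans hb.2⟩

/-- Each section of an ordinal sum of `Π` is a convex combination of two sections of the upper
Fréchet bound, taken at fixed points of the diagonal section. -/
theorem IsOrdinalSumOf.exists_section_eq {C : ℝ → ℝ → ℝ}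
    (h : IsOrdinalSumOf independenceCopula C) {v : ℝ} (hv : v ∈ Icc (0 : ℝ) 1) :
    ∃ a ∈ Icc (0 : ℝ) 1, ∃ b ∈ Icc (0 : ℝ) 1, ∃ r ∈ Icc (0 : ℝ) 1,
      (∀ u ∈ Icc (0 : ℝ) 1, C u a = min u a) ∧ (∀ u ∈ Icc (0 : ℝ) 1, C u b = min u b) ∧
        ∀ u ∈ Icc (0 : ℝ) 1, C u v = (1 - r) * min u a + r * min u b := by
  obtain ⟨ι, a, b, h⟩ := h
  by_cases hk : ∃ k, v ∈ Ioo (a k) (b k)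
  · obtain ⟨k, hk⟩ := hk
    have hab := h.lt k
    have hpos := sub_pos.2 hab
    have haI : a k ∈ Icc (0 : ℝ) 1 := ⟨h.nonneg k, hab.le.trans (h.le_one k)⟩
    have hbI : b k ∈ Icc (0 : ℝ) 1 := ⟨(h.nonneg k).trans hab.le, h.le_one k⟩
    have haN : ∀ l, a k ∉ Ioo (a l) (b l) := by
      intro l
      rcases eq_or_ne k l with rfl | hkl
      · simp
      · exact not_mem_Ioo_of_disjoint_left hab (h.disjoint hkl)
    have hbN : ∀ l, b k ∉ Ioo (a l) (b l) := by
      intro l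
      rcases eq_or_ne k l with rfl | hkl
      · simp
      · exact not_mem_Ioo_of_disjoint_right hab (h.disjoint hkl)
    -- The weight r is chosen so that v = (1 − r) a + r b.
    refine ⟨a k, haI, b k, hbI, (v - a k) / (b k - a k), ⟨?_, ?_⟩, ?_, ?_, ?_⟩
    · exact div_nonneg (sub_nonneg.2 hk.1.le) hpos.le
    · exact (div_le_one hpos).2 (by linarith [hk.2])
    · exact fun u hu => h.eq_outside u hu _ haI fun ⟨l, hl⟩ => haN l hl.2
    · exact fun u hu => h.eq_outside u hu _ hbI fun ⟨l, hl⟩ => hbN l hl.2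
    · intro u hu
      by_cases huk : u ∈ Ioo (a k) (b k)
      · rw [h.eq_inside k u huk v hk, independenceCopula, min_eq_right huk.1.le,
          min_eq_left huk.2.le]
        field_simp
        ring
      · rw [h.eq_outside u hu v hv, upperFrechet]
        · rcases le_or_gt u (a k) with hua | hua
          · rw [min_eq_left hua, min_eq_left (hua.trans hab.le), min_eq_left (hua.trans hk.1.le)]
            ring
          · have hub : b k ≤ u := not_lt.1 fun hlt => huk ⟨hua, hlt⟩
            rw [min_eq_right hua.le, min_eq_right hub, min_eq_right (hk.2.le.trans hub)]
            field_simp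
            ring
        · rintro ⟨l, hul, hvl⟩
          rcases eq_or_ne k l with rfl | hkl
          · exact huk hul
          · exact Set.disjoint_left.1 (h.disjoint hkl) hk hvl
  · have hout : ∀ u ∈ Icc (0 : ℝ) 1, C u v = min u v := fun u hu =>
      h.eq_outside u hu v hv fun ⟨k, hk'⟩ => hk ⟨k, hk'.2⟩
    exact ⟨v, hv, v, hv, 0, by simp, hout, hout, fun u hu => by rw [hout u hu]; ring⟩

/-! ### Converse: monotonicity and idempotence of ordinal sums -/

theorem hasDerivAt_min_const {a t : ℝ} (h : t ≠ a) :
    HasDerivAt (fun s => min s a) ((Iio a).indicator (fun _ => 1) t) t := by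
  rcases lt_or_gt_of_ne h with h | h
  · rw [indicator_of_mem (mem_Iio.2 h)]
    refine (hasDerivAt_id t).congr_of_eventuallyEq ?_
    filter_upwards [Iio_mem_nhds h] with s hs
    exact min_eq_left (le_of_lt hs)
  · rw [indicator_of_notMem (by simpa using h.le)]
    refine (hasDerivAt_const t a).congr_of_eventuallyEq ?_
    filter_upwards [Ioi_mem_nhds h] with s hs
    exact min_eq_right (le_of_lt hs)

/-- At the kink t = a the left derivative still exists and equals 1, hence `Iic` in place of `Iio`.
This lets the left-derivative identity hold at every point. -/
theorem hasDerivWithinAt_min_const (a t : ℝ) :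
    HasDerivWithinAt (fun s => min s a) ((Iic a).indicator (fun _ => 1) t) (Iio t) t := by
  rcases le_or_gt t a with h | h
  · rw [indicator_of_mem (mem_Iic.2 h)]
    exact (hasDerivWithinAt_id t _).congr (fun s hs => min_eq_left ((le_of_lt hs).trans h))
      (min_eq_left h)
  · have := (hasDerivAt_min_const h.ne').hasDerivWithinAt (s := Iio t)
    rw [indicator_of_notMem (by simpa using h)]
    rwa [indicator_of_notMem (by simpa using h.le)] at this

theorem hasDerivAt_section_of_eq {F : ℝ → ℝ} {a b r t : ℝ}
    (hF : ∀ u ∈ Icc (0 : ℝ) 1, F u = (1 - r) * min u a + r * min u b)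
    (ht : t ∈ Ioo (0 : ℝ) 1) (hta : t ≠ a) (htb : t ≠ b) :
    HasDerivAt F ((1 - r) * (Iio a).indicator (fun _ => 1) t +
      r * (Iio b).indicator (fun _ => 1) t) t := by
  refine (((hasDerivAt_min_const hta).const_mul (1 - r)).add
    ((hasDerivAt_min_const htb).const_mul r)).congr_of_eventuallyEq ?_
  filter_upwards [Icc_mem_nhds ht.1 ht.2] with s hs
  exact hF s hs

theorem antitone_indicator_Iio_one (a : ℝ) :
    Antitone ((Iio a).indicator fun _ => (1 : ℝ)) := by
  intro s t hst
  by_cases ht : t < a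
  · simp [ht, hst.trans_lt ht]
  · rw [indicator_of_notMem (by simpa using ht)]
    exact indicator_nonneg (fun _ _ => zero_le_one) _

theorem IsOrdinalSumOf.stochIncreasing_zero {C : ℝ → ℝ → ℝ}
    (h : IsOrdinalSumOf independenceCopula C) : StochIncreasing C 0 := by
  intro v hv
  obtain ⟨a, -, b, -, r, hr, -, -, hsec⟩ := h.exists_section_eq hv
  have hd : ∀ s ∈ Ioo (0 : ℝ) 1 \ {a, b}, HasDerivAt (fun s => C s v) _ s := fun s hs =>
    hasDerivAt_section_of_eq hsec hs.1 (fun e => hs.2 (by simp [e])) fun e => hs.2 (by simp [e])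
  refine ⟨{a, b}, (Set.toFinite _).measure_zero _, fun s hs => (hd s hs).differentiableAt, ?_⟩
  intro s hs t ht hst
  change deriv (fun s => C s v) t ≤ deriv (fun s => C s v) s
  rw [(hd s hs).deriv, (hd t ht).deriv]
  exact add_le_add
    (mul_le_mul_of_nonneg_left (antitone_indicator_Iio_one a hst) (sub_nonneg.2 hr.2))
    (mul_le_mul_of_nonneg_left (antitone_indicator_Iio_one b hst) hr.1)

theorem stochIncreasing_transpose_zero {C : ℝ → ℝ → ℝ} :
    StochIncreasing (fun u v => C v u) 0 ↔ StochIncreasing C 1 := by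
  simp [StochIncreasing, componentSection]

theorem stochDecreasing_transpose_zero {C : ℝ → ℝ → ℝ} :
    StochDecreasing (fun u v => C v u) 0 ↔ StochDecreasing C 1 := by
  simp [StochDecreasing, componentSection]

theorem IsOrdinalSumOf.stochIncreasing {C : ℝ → ℝ → ℝ}
    (h : IsOrdinalSumOf independenceCopula C) (i : Fin 2) : StochIncreasing C i := by
  fin_cases i
  · exact h.stochIncreasing_zero
  · exact stochIncreasing_transpose_zero.1
      (isOrdinalSumOf_independenceCopula_transpose h).stochIncreasing_zero

theorem intervalIntegral_mul_indicator_Iio {F : ℝ → ℝ} {a : ℝ} (ha : a ∈ Icc (0 : ℝ) 1) :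
    ∫ t in (0 : ℝ)..1, F t * (Iio a).indicator (fun _ => 1) t = ∫ t in (0 : ℝ)..a, F t := by
  have : (fun t => F t * (Iio a).indicator (fun _ => 1) t) = (Iio a).indicator F := by
    funext t
    by_cases ht : t < a <;> simp [indicator, ht]
  rw [this, intervalIntegral.integral_of_le zero_le_one, integral_indicator measurableSet_Iio,
    Measure.restrict_restrict measurableSet_Iio, intervalIntegral.integral_of_le ha.1,
    integral_Ioc_eq_integral_Ioo]
  congr 2
  ext t
  simp only [mem_inter_iff, mem_Iio, mem_Ioc, mem_Ioo]
  exact ⟨fun h => ⟨h.2.1, h.1⟩, fun h => ⟨h.2, h.1, h.2.le.trans ha.2⟩⟩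

/-- Differentiating min(·,p) gives an indicator, and ∫₀ᵖ ∂₂C(u,t) dt = C(u,p) = min(u,p) for p = a,
b. The product thus reproduces the convex combination. -/
theorem IsOrdinalSumOf.isMarkovIdempotent {C : ℝ → ℝ → ℝ} (hC : IsCopula C)
    (h : IsOrdinalSumOf independenceCopula C) : IsMarkovIdempotent C := by
  intro u hu v hv
  have h0 : (0 : ℝ) ∈ Icc (0 : ℝ) 1 := by simp
  have h1 : (1 : ℝ) ∈ Icc (0 : ℝ) 1 := by simp
  obtain ⟨a, ha, b, hb, r, hr, hCa, hCb, hsec⟩ := h.exists_section_eq hv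
  have hI : ∀ p : ℝ, IntervalIntegrable
      (fun t => deriv (C u) t * (Iio p).indicator (fun _ => 1) t) volume 0 1 := by
    intro p
    have hdi := hC.intervalIntegrable_deriv_right hu h0 h1
    rw [intervalIntegrable_iff_integrableOn_Ioc_of_le zero_le_one] at hdi ⊢
    refine (Integrable.indicator hdi (measurableSet_Iio (a := p))).congr
      (Filter.Eventually.of_forall fun t => ?_)
    by_cases ht : t < p <;> simp [indicator, ht]
  calc markovProduct C C u v
      = ∫ t in (0 : ℝ)..1, ((1 - r) * (deriv (C u) t * (Iio a).indicator (fun _ => 1) t) +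
          r * (deriv (C u) t * (Iio b).indicator (fun _ => 1) t)) := by
        refine intervalIntegral.integral_congr_ae ?_
        have hta : ∀ᵐ t : ℝ, t ≠ a := by simp [ae_iff]
        have htb : ∀ᵐ t : ℝ, t ≠ b := by simp [ae_iff]
        have ht1 : ∀ᵐ t : ℝ, t ≠ 1 := by simp [ae_iff]
        filter_upwards [hta, htb, ht1] with t hta htb ht1 ht
        rw [uIoc_of_le zero_le_one] at ht
        rw [(hasDerivAt_section_of_eq hsec ⟨ht.1, lt_of_le_of_ne ht.2 ht1⟩ hta htb).deriv]
        ring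
    _ = C u v := by
        rw [intervalIntegral.integral_add ((hI a).const_mul _) ((hI b).const_mul _),
          intervalIntegral.integral_const_mul, intervalIntegral.integral_const_mul,
          intervalIntegral_mul_indicator_Iio ha, intervalIntegral_mul_indicator_Iio hb,
          hC.integral_deriv_right hu h0 ha, hC.integral_deriv_right hu h0 hb,
          hC.zero_right u hu, hCa u hu, hCb u hu, hsec u hu]
        ring

/-! ### The left-derivative identity -/

theorem IsOrdinalSumOf.exists_hasDerivWithinAt {C : ℝ → ℝ → ℝ} (hC : IsCopula C)
    (h : IsOrdinalSumOf independenceCopula C) {u v : ℝ} (hu : u ∈ Icc (0 : ℝ) 1)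
    (hv : v ∈ Ioo (0 : ℝ) 1) :
    ∃ d : ℝ, HasDerivWithinAt (fun t => C u t) d (Iio v) v ∧
      (v - C v v) * d = C u v - C u (C v v) := by
  obtain ⟨a, ha, b, hb, r, hr, hCa, hCb, hsec⟩ :=
    (isOrdinalSumOf_independenceCopula_transpose h).exists_section_eq hu
  have hvI := Ioo_subset_Icc_self hv
  have hwv : C v v ≤ v := (hC.le_min hvI hvI).trans (min_le_left _ _)
  have hwI : C v v ∈ Icc (0 : ℝ) 1 :=
    ⟨(hC.zero_right v hvI).symm.le.trans (hC.mono_right hvI (by simp) hvI hvI.1),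
      hwv.trans hvI.2⟩
  -- This is the identity for the section min(·,p). If v ≤ p both sides are v − C(v,v); if p < v
  -- then p = C(p,v) ≤ C(v,v), and both sides vanish.
  have key : ∀ p ∈ Icc (0 : ℝ) 1, (∀ t ∈ Icc (0 : ℝ) 1, C p t = min t p) →
      (v - C v v) * (Iic p).indicator (fun _ => 1) v = min v p - min (C v v) p := by
    intro p hp hCp
    rcases le_or_gt v p with hvp | hvp
    · rw [indicator_of_mem (mem_Iic.2 hvp), min_eq_left hvp, min_eq_left (hwv.trans hvp), mul_one]
    · have hpw : p ≤ C v v := by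
        have := hCp v hvI
        rw [min_eq_right hvp.le] at this
        exact this.symm.le.trans (hC.mono_left hvI hp hvI hvp.le)
      rw [indicator_of_notMem (by simpa using hvp), min_eq_right hvp.le, min_eq_right hpw]
      ring
  refine ⟨(1 - r) * (Iic a).indicator (fun _ => 1) v + r * (Iic b).indicator (fun _ => 1) v,
    ?_, ?_⟩
  · refine (((hasDerivWithinAt_min_const a v).const_mul (1 - r)).add
      ((hasDerivWithinAt_min_const b v).const_mul r)).congr_of_eventuallyEq ?_ (hsec v hvI)
    filter_upwards [mem_nhdsWithin_of_mem_nhds (Icc_mem_nhds hv.1 hv.2)] with t ht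
    exact hsec t ht
  · rw [hsec v hvI, hsec _ hwI]
    linear_combination (1 - r) * key a ha hCa + r * key b hb hCb

theorem stochDecreasing_of_eq_independenceCopula {C : ℝ → ℝ → ℝ}
    (h : ∀ u ∈ Icc (0 : ℝ) 1, ∀ v ∈ Icc (0 : ℝ) 1, C u v = independenceCopula u v)
    (i : Fin 2) : StochDecreasing C i := by
  intro w hw
  have hd : ∀ s ∈ Ioo (0 : ℝ) 1, HasDerivAt (componentSection C i w) w s := by
    intro s hs
    have hlin : HasDerivAt (fun t : ℝ => t * w) w s := by
      simpa using (hasDerivAt_id s).mul_const w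
    refine hlin.congr_of_eventuallyEq ?_
    filter_upwards [Icc_mem_nhds hs.1 hs.2] with t ht
    unfold componentSection
    split_ifs
    · exact h t ht w hw
    · exact (h w hw t ht).trans (mul_comm w t)
  refine ⟨∅, measure_empty, fun s hs => (hd s hs.1).differentiableAt, fun s hs t ht _ => ?_⟩
  rw [(hd s hs.1).deriv, (hd t ht.1).deriv]

/-! ### Both components and the main theorem -/

theorem IsCopula.isOrdinalSumOf_of_stochMonotone {C : ℝ → ℝ → ℝ} (hC : IsCopula C) {i : Fin 2}
    (hmono : StochMonotone C i) (hidem : IsMarkovIdempotent C) :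
    IsOrdinalSumOf independenceCopula C := by
  fin_cases i
  · exact hC.isOrdinalSumOf hmono hidem
  · exact isOrdinalSumOf_independenceCopula_transpose (hC.transpose.isOrdinalSumOf
      (hmono.imp stochIncreasing_transpose_zero.2 stochDecreasing_transpose_zero.2)
      hidem.transpose)

theorem IsCopula.eq_independenceCopula {C : ℝ → ℝ → ℝ} (hC : IsCopula C) {i : Fin 2}
    (hdec : StochDecreasing C i) (hidem : IsMarkovIdempotent C) :
    ∀ u ∈ Icc (0 : ℝ) 1, ∀ v ∈ Icc (0 : ℝ) 1, C u v = independenceCopula u v := by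
  fin_cases i
  · exact hC.eq_independenceCopula_of_stochDecreasing hdec hidem
  · intro u hu v hv
    have := hC.transpose.eq_independenceCopula_of_stochDecreasing
      (stochDecreasing_transpose_zero.2 hdec) hidem.transpose v hv u hu
    exact this.trans (mul_comm v u)

theorem mainTheorem1 (C : ℝ → ℝ → ℝ) (hC : IsCopula C) (i : Fin 2) :
    ((StochMonotone C i ∧ IsMarkovIdempotent C) ↔ IsOrdinalSumOf independenceCopula C) ∧
    ((StochDecreasing C i ∧ IsMarkovIdempotent C) ↔
      ∀ u ∈ Icc (0 : ℝ) 1, ∀ v ∈ Icc (0 : ℝ) 1, C u v = independenceCopula u v) ∧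
    ((StochIncreasing C i ∧ IsMarkovIdempotent C) ↔ IsOrdinalSumOf independenceCopula C) ∧
    ((StochIncreasing C i ∧ IsMarkovIdempotent C) →
      ∀ u ∈ Ioo (0 : ℝ) 1, ∀ v ∈ Ioo (0 : ℝ) 1, ∃ d : ℝ,
        HasDerivWithinAt (fun t => C u t) d (Iio v) v ∧
          (v - C v v) * d = C u v - C u (C v v)) := by
  refine ⟨⟨fun h => hC.isOrdinalSumOf_of_stochMonotone h.1 h.2,
      fun h => ⟨Or.inl (h.stochIncreasing i), h.isMarkovIdempotent hC⟩⟩,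
    ⟨fun h => hC.eq_independenceCopula h.1 h.2,
      fun h => ⟨stochDecreasing_of_eq_independenceCopula h i,
        (isOrdinalSumOf_of_eq_independenceCopula h).isMarkovIdempotent hC⟩⟩,
    ⟨fun h => hC.isOrdinalSumOf_of_stochMonotone (Or.inl h.1) h.2,
      fun h => ⟨h.stochIncreasing i, h.isMarkovIdempotent hC⟩⟩,
    fun h u hu v hv => ?_⟩
  exact (hC.isOrdinalSumOf_of_stochMonotone (Or.inl h.1) h.2).exists_hasDerivWithinAt hC
    (Ioo_subset_Icc_self hu) hv
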